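/- All systems are finite-dimensional with fixed orthonormal bases; $|A|$ denotes the dimension of $A$, and a quantum channel is a completely positive trace-preserving linear map. For a bipartite system, $T_B$ denotes the partial transpose on $B$. A quantum channel $\mathcal{P}_{AB\to A'B'}$ is called PPT-preserving (PPT-P) if $T_{B'}\circ\mathcal{P}_{AB\to A'B'}\circ T_B$ is also a quantum channel. Let $$\mathrm{PPT}'(A\!:\!B)=\{\sigma_{AB}:\ \sigma_{AB}\ge 0,\ \|T_B(\sigma_{AB})\|_1\le 1\},\qquad D_{\max}(\rho\|\sigma)=\inf\{\lambda\in\mathbb{R}:\ \rho\le 2^{\lambda}\sigma\},$$ where $D_{\max}(\rho\|\sigma)=\infty$ if there is no such $\lambda$. The max-Rains relative entropy of a state $\rho_{AB}$ is $R_{\max}(A;B)_\rho=\min_{\sigma_{AB}\in\mathrm{PPT}'(A:B)}D_{\max}(\rho_{AB}\|\sigma_{AB})$, and the max-Rains information of a quantum channel $\mathcal{N}_{A\to B}$ is $$R_{\max}(\mathcal{N})=\max_{\phi_{SA}}R_{\max}(S;B)_{\omega},\qquad \omega_{SB}=(\mathrm{id}_S\otimes\mathcal{N}_{A\to B})(\phi_{SA}),$$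 the maximum being over all pure states $\phi_{SA}$ with $|S|=|A|$. Let $n,M\ge 1$ be integers. A protocol for PPT-P-assisted quantum communication that uses $\mathcal{N}_{A\to B}$ $n$ times consists of auxiliary systems $A_i',B_i'$ ($1\le i\le n$) of arbitrary finite dimensions and of PPT-P channels $\mathcal{P}^{(1)}_{\emptyset\to A_1'A_1:B_1'}$ (from a trivial system), $\mathcal{P}^{(i)}_{A_{i-1}':B_{i-1}B_{i-1}'\to A_i'A_i:B_i'}$ for $2\le i\le n$, and $\mathcal{P}^{(n+1)}_{A_n':B_nB_n'\to M_A:M_B}$, where the colon separates Alice's systems from Bob's, $A_i\cong A$, $B_i\cong B$ and $|M_A|=|M_B|=M$. Let $\rho^{(1)}$ be the state prepared by $\mathcal{P}^{(1)}$, let $\sigma^{(i)}=\mathcal{N}_{A_i\to B_i}(\rho^{(i)})$ for $1\le i\le n$ and $\rho^{(i)}=\mathcal{P}^{(i)}(\sigma^{(i-1)})$ for $2\le i\le n$, and let $\omega_{M_AM_B}=\mathcal{P}^{(n+1)}(\sigma^{(n)})$ be the final state. The protocol is an $(n,M,\varepsilon)$ protocol if $F(\omega_{M_AM_B},\Phi_{M_AM_B})\ge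 1-\varepsilon$, where $F(\tau,\kappa)=\|\sqrt{\tau}\sqrt{\kappa}\|_1^2$ and $\Phi_{M_AM_B}=|\Phi\rangle\langle\Phi|$ with $|\Phi\rangle=\frac{1}{\sqrt M}\sum_{m=1}^{M}|m\rangle_{M_A}\otimes|m\rangle_{M_B}$. **Theorem.** Let $\mathcal{N}$ be a quantum channel, let $n,M\ge 1$ be integers and let $\varepsilon\in(0,1)$. Every $(n,M,\varepsilon)$ protocol for PPT-P-assisted quantum communication over $\mathcal{N}$ satisfies $$\log_2 M\ \le\ n\,R_{\max}(\mathcal{N})+\log_2\!\left(\frac{1}{1-\varepsilon}\right).$$ -/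

import Mathlib

open scoped Matrix MatrixOrder ComplexOrder

noncomputable section

namespace MaxRains

/-!
Finite-dimensional quantum systems are represented by finite index types `α` (a fixed orthonormal
basis), operators on them by `Matrix α α ℂ`, and composite systems by product types.
The order `≤` on matrices is the Loewner order.
-/

/-- The operator `(id_κ ⊗ N)(X)`, for an operator `X` on the composite system `κ × α`. -/
def idTensor {α β : Type*} (κ : Type*) (N : Matrix α α ℂ →ₗ[ℂ] Matrix β β ℂ)
    (X : Matrix (κ × α) (κ × α) ℂ) : Matrix (κ × β) (κ × β) ℂ :=
  Matrix.of fun p q => N (Matrix.of fun i j => X (p.1, i) (q.1, j)) p.2 q.2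

/-- Complete positivity: `id_k ⊗ N` maps positive semidefinite operators to positive semidefinite
operators, for every `k`. -/
def IsCompletelyPositive {α β : Type*} (N : Matrix α α ℂ →ₗ[ℂ] Matrix β β ℂ) : Prop :=
  ∀ (k : ℕ) (X : Matrix (Fin k × α) (Fin k × α) ℂ), 0 ≤ X → 0 ≤ idTensor (Fin k) N X

/-- Quantum channels: completely positive trace-preserving linear maps. -/
def IsQuantumChannel {α β : Type*} [Fintype α] [Fintype β]
    (N : Matrix α α ℂ →ₗ[ℂ] Matrix β β ℂ) : Prop :=
  IsCompletelyPositive N ∧ ∀ X, (N X).trace = X.trace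

/-- The partial transpose `T_B` on the second tensor factor of a bipartite system. -/
def partialTranspose {α β : Type*} :
    Matrix (α × β) (α × β) ℂ →ₗ[ℂ] Matrix (α × β) (α × β) ℂ where
  toFun X := Matrix.of fun p q => X (p.1, q.2) (q.1, p.2)
  map_add' _ _ := rfl
  map_smul' _ _ := rfl

/-- PPT-preserving (PPT-P) channels from the bipartite system `A : B` to `A' : B'`: quantum
channels `N` such that `T_{B'} ∘ N ∘ T_B` is also a quantum channel. -/
def IsPPTPreserving {α β α' β' : Type*} [Fintype α] [Fintype β] [Fintype α'] [Fintype β']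
    (N : Matrix (α × β) (α × β) ℂ →ₗ[ℂ] Matrix (α' × β') (α' × β') ℂ) : Prop :=
  IsQuantumChannel N ∧ IsQuantumChannel (partialTranspose ∘ₗ N ∘ₗ partialTranspose)

/-- The trace norm `‖X‖₁ = Tr |X|`, where `|X| = √(X† X)`. -/
def traceNorm {α : Type*} [Fintype α] [DecidableEq α] (X : Matrix α α ℂ) : ℝ :=
  (CFC.abs X).trace.re

/-- The set `PPT'(A : B)`. -/
def PPTPrime (α β : Type*) [Fintype α] [DecidableEq α] [Fintype β] [DecidableEq β] :
    Set (Matrix (α × β) (α × β) ℂ) :=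
  {σ | 0 ≤ σ ∧ traceNorm (partialTranspose σ) ≤ 1}

/-- The max-relative entropy `D_max(ρ‖σ) = inf {r : ρ ≤ 2 ^ r σ}`; it is `⊤` when there is no such
real number `r`. -/
def Dmax {α : Type*} (ρ σ : Matrix α α ℂ) : EReal :=
  ⨅ (r : ℝ) (_ : ρ ≤ ((2 : ℝ) ^ r) • σ), (r : EReal)

/-- The max-Rains relative entropy `R_max(A;B)_ρ`. -/
def maxRainsEntropy {α β : Type*} [Fintype α] [DecidableEq α] [Fintype β] [DecidableEq β]
    (ρ : Matrix (α × β) (α × β) ℂ) : EReal :=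
  ⨅ σ ∈ PPTPrime α β, Dmax ρ σ

/-- The rank-one operator `|ψ⟩⟨ψ|`. -/
def ketBra {α : Type*} (ψ : α → ℂ) : Matrix α α ℂ := Matrix.vecMulVec ψ (star ψ)

/-- The max-Rains information `R_max(N)` of a channel `N` from `A` to `B`: the supremum of
`R_max(S;B)` of `(id_S ⊗ N)(|ψ⟩⟨ψ|)` over the unit vectors `ψ` of `S ⊗ A`, with `S` a copy
of `A`. -/
def maxRainsInformation {a b : Type*} [Fintype a] [DecidableEq a] [Fintype b] [DecidableEq b]
    (N : Matrix a a ℂ →ₗ[ℂ] Matrix b b ℂ) : EReal :=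
  ⨆ (ψ : a × a → ℂ) (_ : ∑ x, ‖ψ x‖ ^ 2 = 1), maxRainsEntropy (idTensor a N (ketBra ψ))

/-- One use of the channel `N` from `A` to `B`: it acts on the middle factor of an operator on
`A' A B'`. Before the use the bipartition is `A' A : B'`, and after it, it is `A' : B B'`. -/
def useChannel {a b α β : Type*} (N : Matrix a a ℂ →ₗ[ℂ] Matrix b b ℂ)
    (ρ : Matrix ((α × a) × β) ((α × a) × β) ℂ) : Matrix (α × (b × β)) (α × (b × β)) ℂ :=
  Matrix.of fun p q =>
    N (Matrix.of fun i j => ρ ((p.1, i), p.2.2) ((q.1, j), q.2.2)) p.2.1 q.2.1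

/-- The PPT-P-assisted protocols that use `n ≥ 1` times a channel from `A` to `B` and end with a
state of two `M`-dimensional systems. The indices `i = 0, …, n - 1` number the channel uses: Alice
and Bob hold auxiliary systems of dimensions `dA i` and `dB i` during use `i`. A PPT-P channel
`first` from the trivial system prepares the state before the first use, the PPT-P channel
`next i` is performed between the uses `i` and `i + 1`, and the PPT-P channel `last` after the last
use. (The data with an index outside this range play no role.) -/
structure PPTPProtocol (a b : Type*) [Fintype a] [Fintype b] (n M : ℕ) where
  dA : ℕ → ℕ
  dB : ℕ → ℕ
  first : Matrix (Unit × Unit) (Unit × Unit) ℂ →ₗ[ℂ]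
    Matrix ((Fin (dA 0) × a) × Fin (dB 0)) ((Fin (dA 0) × a) × Fin (dB 0)) ℂ
  first_ppt : IsPPTPreserving first
  next : (i : ℕ) →
    Matrix (Fin (dA i) × (b × Fin (dB i))) (Fin (dA i) × (b × Fin (dB i))) ℂ →ₗ[ℂ]
      Matrix ((Fin (dA (i + 1)) × a) × Fin (dB (i + 1)))
        ((Fin (dA (i + 1)) × a) × Fin (dB (i + 1))) ℂ
  next_ppt : ∀ i, i + 1 < n → IsPPTPreserving (next i)
  last : Matrix (Fin (dA (n - 1)) × (b × Fin (dB (n - 1))))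
      (Fin (dA (n - 1)) × (b × Fin (dB (n - 1)))) ℂ →ₗ[ℂ]
    Matrix (Fin M × Fin M) (Fin M × Fin M) ℂ
  last_ppt : IsPPTPreserving last

namespace PPTPProtocol

variable {a b : Type*} [Fintype a] [Fintype b] {n M : ℕ}

/-- The state just before channel use `i`. -/
def stateBefore (P : PPTPProtocol a b n M) (N : Matrix a a ℂ →ₗ[ℂ] Matrix b b ℂ) : (i : ℕ) →
    Matrix ((Fin (P.dA i) × a) × Fin (P.dB i)) ((Fin (P.dA i) × a) × Fin (P.dB i)) ℂ
  | 0 => P.first 1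
  | i + 1 => P.next i (useChannel N (stateBefore P N i))

/-- The state just after channel use `i`. -/
def stateAfter (P : PPTPProtocol a b n M) (N : Matrix a a ℂ →ₗ[ℂ] Matrix b b ℂ) (i : ℕ) :
    Matrix (Fin (P.dA i) × (b × Fin (P.dB i))) (Fin (P.dA i) × (b × Fin (P.dB i))) ℂ :=
  useChannel N (P.stateBefore N i)

/-- The final state of the protocol, on the systems `M_A` and `M_B`. -/
def finalState (P : PPTPProtocol a b n M) (N : Matrix a a ℂ →ₗ[ℂ] Matrix b b ℂ) :
    Matrix (Fin M × Fin M) (Fin M × Fin M) ℂ :=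
  P.last (P.stateAfter N (n - 1))

end PPTPProtocol

/-- The fidelity `F(τ,κ) = ‖√τ √κ‖₁²`. -/
def fidelity {α : Type*} [Fintype α] [DecidableEq α] (τ κ : Matrix α α ℂ) : ℝ :=
  traceNorm (CFC.sqrt τ * CFC.sqrt κ) ^ 2

/-- The maximally entangled state `Φ` of two `M`-dimensional systems. -/
def maxEntangledState (M : ℕ) : Matrix (Fin M × Fin M) (Fin M × Fin M) ℂ :=
  ketBra fun p => if p.1 = p.2 then ((1 / Real.sqrt M : ℝ) : ℂ) else 0

/-- `P` is an `(n, M, ε)` protocol for PPT-P-assisted quantum communication over `N`. -/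
def IsEpsProtocol {a b : Type*} [Fintype a] [Fintype b] {n M : ℕ}
    (N : Matrix a a ℂ →ₗ[ℂ] Matrix b b ℂ) (P : PPTPProtocol a b n M) (ε : ℝ) : Prop :=
  1 - ε ≤ fidelity (P.finalState N) (maxEntangledState M)

end MaxRains

end

noncomputable section

namespace MaxRains

/-! ### Positive semidefinite matrices -/

/-! Splitting `T_B(σ)` into positive and negative parts turns the max-Rains quantity of `ρ` into the
least `Tr (P + Q)` over `P, Q ≥ 0` with `ρ ≤ T_B (P - Q)`. A channel with Choi matrix `J` has an
analogous certificate: `V, Y ≥ 0` with `J ≤ T_B (V - Y)` and `Tr_B (V + Y) ≤ r`. These certificates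
multiply. Contracting `P - Q` with `V - Y` and collecting terms by sign gives a certificate of value
`r * s` after one channel use (`HasRainsBound.useChannel`), while PPT-P maps do not increase the
value (`HasRainsBound.map`). The final state thus has value `r ^ n`, and its overlap with `Φ` is at
most `r ^ n / M`, because `T_B (Φ)` is the swap divided by `M` (`HasRainsBound.fidelity_le`). It
remains to find one pair `(V, Y)` with `r` close to `2 ^ R_max(N)`. Each input state gives its own
pair, and Sion's minimax theorem, applied to `Tr (ρ Tr_B (V + Y))` over the compact set of density
matrices, exchanges the quantifiers (`hasChannelRainsBound_of_forall_lt`). -/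

theorem nonneg_submatrix {ι κ : Type*} {X : Matrix ι ι ℂ} (hX : 0 ≤ X) (f : κ → ι) :
    0 ≤ X.submatrix f f :=
  Matrix.nonneg_iff_posSemidef.2 ((Matrix.nonneg_iff_posSemidef.1 hX).submatrix f)

theorem nonneg_conj {ι κ : Type*} [Fintype ι] [Fintype κ] {X : Matrix ι ι ℂ} (hX : 0 ≤ X)
    (C : Matrix κ ι ℂ) : 0 ≤ C * X * Cᴴ :=
  Matrix.nonneg_iff_posSemidef.2 ((Matrix.nonneg_iff_posSemidef.1 hX).mul_mul_conjTranspose_same C)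

theorem re_trace_nonneg {ι : Type*} [Fintype ι] {X : Matrix ι ι ℂ} (hX : 0 ≤ X) :
    0 ≤ X.trace.re :=
  (Complex.nonneg_iff.1 (Matrix.nonneg_iff_posSemidef.1 hX).trace_nonneg).1

theorem smul_nonneg_of_nonneg {ι : Type*} [Fintype ι] {X : Matrix ι ι ℂ} (hX : 0 ≤ X) {t : ℝ}
    (ht : 0 ≤ t) : 0 ≤ t • X :=
  Matrix.nonneg_iff_posSemidef.2 ((Matrix.nonneg_iff_posSemidef.1 hX).smul ht)

theorem ketBra_nonneg {ι : Type*} [Finite ι] (ψ : ι → ℂ) : 0 ≤ ketBra ψ := by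
  rw [Matrix.nonneg_iff_posSemidef]
  exact Matrix.posSemidef_vecMulVec_self_star ψ

/-- Summing the blocks of a positive semidefinite block matrix gives a positive semidefinite
matrix. -/
theorem nonneg_sum_blocks {ι κ : Type*} [Fintype ι] [Fintype κ]
    {X : Matrix (ι × κ) (ι × κ) ℂ} (hX : 0 ≤ X) :
    0 ≤ (Matrix.of fun p q => ∑ i, ∑ j, X (p, i) (q, j) : Matrix ι ι ℂ) := by
  classical
  -- The conjugating matrix is the identity tensored with the all-ones row vector.
  have h := nonneg_conj hX (Matrix.of fun p x => if p = x.1 then 1 else 0 : Matrix ι (ι × κ) ℂ)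
  convert h using 1
  ext p q
  simp only [Matrix.mul_apply, Matrix.of_apply, Matrix.conjTranspose_apply, Fintype.sum_prod_type,
    ite_mul, one_mul, zero_mul, apply_ite star, star_one, star_zero, mul_ite, mul_one, mul_zero]
  rw [Finset.sum_eq_single q (by intro b _ hb; simp [hb.symm]) (by simp)]
  simp only [if_true]
  rw [Finset.sum_comm]
  refine Finset.sum_congr rfl fun j _ => ?_
  rw [Finset.sum_eq_single p (by intro b _ hb; simp [hb.symm]) (by simp)]
  simp

/-- The quadratic form of `X` is nonnegative at `e_x + e_y` and at `e_x - e_y`. -/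
theorem two_mul_re_le_of_nonneg {ι : Type*} [Fintype ι] {X : Matrix ι ι ℂ} (hX : 0 ≤ X)
    (x y : ι) :
    |2 * (X x y).re| ≤ (X x x).re + (X y y).re := by
  classical
  have hX' := Matrix.nonneg_iff_posSemidef.1 hX
  have hxy : (X y x).re = (X x y).re := by
    have := hX'.1.apply x y
    rw [← this]; simp
  have key (c : ℝ) : 0 ≤ (X x x).re + c * ((X x y).re + (X y x).re) + c * c * (X y y).re := by
    have h := nonneg_conj hX (Matrix.of fun (_ : Unit) i =>
      (if i = x then 1 else 0) + (if i = y then (c : ℂ) else 0))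
    have h2 := re_trace_nonneg h
    have e : (∑ i, ∑ j, ((if j = x then 1 else 0) + if j = y then (c : ℂ) else 0) * X j i *
        star ((if i = x then 1 else 0) + if i = y then (c : ℂ) else 0)) =
        X x x + c * (X x y + X y x) + c * c * X y y := by
      simp [add_mul, mul_add, Finset.sum_add_distrib, apply_ite (starRingEnd ℂ)]
      ring
    simp only [Matrix.trace, Matrix.diag_apply, Matrix.mul_apply, Matrix.of_apply,
      Matrix.conjTranspose_apply, Finset.univ_unique, Finset.sum_singleton, Finset.sum_mul] at h2
    rw [e] at h2
    simpa using h2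
  have h1 := key 1
  have h2 := key (-1)
  rw [abs_le]
  constructor <;> linarith

/-! ### Completely positive maps and their Choi matrices -/

section

variable {α β : Type*}

theorem idTensor_nonneg {N : Matrix α α ℂ →ₗ[ℂ] Matrix β β ℂ} (hN : IsCompletelyPositive N)
    {κ : Type*} [Fintype κ] {X : Matrix (κ × α) (κ × α) ℂ} (hX : 0 ≤ X) :
    0 ≤ idTensor κ N X := by
  have e := Fintype.equivFin κ
  have h := hN _ _ (nonneg_submatrix hX (fun p : Fin (Fintype.card κ) × α => (e.symm p.1, p.2)))
  have h2 := nonneg_submatrix h (fun p : κ × β => (e p.1, p.2))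
  convert h2 using 1
  ext p q
  simp [idTensor]

theorem IsCompletelyPositive.map_nonneg {N : Matrix α α ℂ →ₗ[ℂ] Matrix β β ℂ}
    (hN : IsCompletelyPositive N) {X : Matrix α α ℂ} (hX : 0 ≤ X) : 0 ≤ N X :=
  nonneg_submatrix (idTensor_nonneg hN (κ := Unit) (nonneg_submatrix hX Prod.snd))
    (fun i => ((), i))

theorem IsCompletelyPositive.map_mono {N : Matrix α α ℂ →ₗ[ℂ] Matrix β β ℂ}
    (hN : IsCompletelyPositive N) {X Y : Matrix α α ℂ} (h : X ≤ Y) : N X ≤ N Y := by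
  rw [← sub_nonneg] at h ⊢
  rw [← map_sub]
  exact hN.map_nonneg h

/-- The Choi matrix of a linear map between matrix algebras. -/
def choi [DecidableEq α] (N : Matrix α α ℂ →ₗ[ℂ] Matrix β β ℂ) : Matrix (α × β) (α × β) ℂ :=
  Matrix.of fun p q => N (Matrix.single p.1 q.1 1) p.2 q.2

/-- The Choi matrix is the image of the unnormalized maximally entangled state. -/
theorem choi_nonneg [Fintype α] [DecidableEq α] {N : Matrix α α ℂ →ₗ[ℂ] Matrix β β ℂ}
    (hN : IsCompletelyPositive N) : 0 ≤ choi N := by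
  have h := idTensor_nonneg hN (ketBra_nonneg (fun p : α × α => if p.1 = p.2 then 1 else 0))
  convert h using 1
  ext p q
  simp only [choi, idTensor, Matrix.of_apply]
  refine congrFun (congrFun (congrArg N ?_) _) _
  ext i j
  simp only [Matrix.single, ketBra, Matrix.vecMulVec, Matrix.of_apply, Pi.star_apply]
  split_ifs <;> simp_all

theorem map_apply_eq_choi [Fintype α] [DecidableEq α] (N : Matrix α α ℂ →ₗ[ℂ] Matrix β β ℂ)
    (X : Matrix α α ℂ) (p q : β) :
    N X p q = ∑ i, ∑ j, X i j * choi N (i, p) (j, q) := by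
  conv_lhs => rw [Matrix.matrix_eq_sum_single X]
  have (i j : α) : Matrix.single i j (X i j) = X i j • Matrix.single i j (1 : ℂ) := by
    simp [Matrix.smul_single]
  simp only [map_sum, this, map_smul, Matrix.sum_apply, Matrix.smul_apply, smul_eq_mul, choi,
    Matrix.of_apply]

end

/-! ### Partial transposition -/

section

variable {α β : Type*}

@[simp] theorem partialTranspose_partialTranspose (X : Matrix (α × β) (α × β) ℂ) :
    partialTranspose (partialTranspose X) = X := rfl

theorem partialTranspose_apply (X : Matrix (α × β) (α × β) ℂ) (p q : α × β) :
    partialTranspose X p q = X (p.1, q.2) (q.1, p.2) := rfl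

theorem trace_partialTranspose [Fintype α] [Fintype β] (X : Matrix (α × β) (α × β) ℂ) :
    (partialTranspose X).trace = X.trace := rfl

theorem partialTranspose_real_smul (t : ℝ) (X : Matrix (α × β) (α × β) ℂ) :
    partialTranspose (t • X) = t • partialTranspose X := rfl

end

/-! ### Contraction of a state with a Choi matrix -/

section

variable {a b α β : Type*} [Fintype a]

/-- The action on the middle factor of `ρ` of the linear map with Choi matrix `W`. -/
def contract (W : Matrix (a × b) (a × b) ℂ) (ρ : Matrix ((α × a) × β) ((α × a) × β) ℂ) :
    Matrix (α × (b × β)) (α × (b × β)) ℂ :=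
  Matrix.of fun p q => ∑ i, ∑ j, ρ ((p.1, i), p.2.2) ((q.1, j), q.2.2) * W (i, p.2.1) (j, q.2.1)

theorem useChannel_eq_contract [DecidableEq a] (N : Matrix a a ℂ →ₗ[ℂ] Matrix b b ℂ)
    (ρ : Matrix ((α × a) × β) ((α × a) × β) ℂ) :
    useChannel N ρ = contract (choi N) ρ := by
  ext p q
  simp [useChannel, map_apply_eq_choi, contract]

theorem contract_sub_left (W W' : Matrix (a × b) (a × b) ℂ)
    (ρ : Matrix ((α × a) × β) ((α × a) × β) ℂ) :
    contract (W - W') ρ = contract W ρ - contract W' ρ := by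
  ext p q
  simp [contract, mul_sub, Finset.sum_sub_distrib]

theorem contract_sub_right (W : Matrix (a × b) (a × b) ℂ)
    (ρ ρ' : Matrix ((α × a) × β) ((α × a) × β) ℂ) :
    contract W (ρ - ρ') = contract W ρ - contract W ρ' := by
  ext p q
  simp [contract, sub_mul, Finset.sum_sub_distrib]

theorem contract_add_left (W W' : Matrix (a × b) (a × b) ℂ)
    (ρ : Matrix ((α × a) × β) ((α × a) × β) ℂ) :
    contract (W + W') ρ = contract W ρ + contract W' ρ := by
  ext p q
  simp [contract, mul_add, Finset.sum_add_distrib]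

theorem contract_add_right (W : Matrix (a × b) (a × b) ℂ)
    (ρ ρ' : Matrix ((α × a) × β) ((α × a) × β) ℂ) :
    contract W (ρ + ρ') = contract W ρ + contract W ρ' := by
  ext p q
  simp [contract, add_mul, Finset.sum_add_distrib]

/-- The contraction sums only over Alice's index `a`, so transposing Bob's indices `b` and `β` can
be done factor by factor. This is what lets certificates compose. -/
theorem partialTranspose_contract (W : Matrix (a × b) (a × b) ℂ)
    (ρ : Matrix ((α × a) × β) ((α × a) × β) ℂ) :
    partialTranspose (contract W ρ) = contract (partialTranspose W) (partialTranspose ρ) := rfl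

theorem contract_nonneg [Fintype b] [Fintype α] [Fintype β] {W : Matrix (a × b) (a × b) ℂ}
    (hW : 0 ≤ W) {ρ : Matrix ((α × a) × β) ((α × a) × β) ℂ} (hρ : 0 ≤ ρ) :
    0 ≤ contract W ρ := by
  have h : 0 ≤ Matrix.kronecker ρ W := Matrix.nonneg_iff_posSemidef.2
    ((Matrix.nonneg_iff_posSemidef.1 hρ).kronecker (Matrix.nonneg_iff_posSemidef.1 hW))
  -- Identifying the two copies of `a` in `ρ ⊗ W` and summing over blocks is compression by an
  -- unnormalized maximally entangled vector.
  have h2 := nonneg_sum_blocks (nonneg_submatrix h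
    (fun x : (α × (b × β)) × a => (((x.1.1, x.2), x.1.2.2), (x.2, x.1.2.1))))
  have e : contract W ρ = Matrix.of fun p q => ∑ i, ∑ j, (Matrix.kronecker ρ W).submatrix
      (fun x : (α × (b × β)) × a => (((x.1.1, x.2), x.1.2.2), (x.2, x.1.2.1)))
      (fun x : (α × (b × β)) × a => (((x.1.1, x.2), x.1.2.2), (x.2, x.1.2.1))) (p, i) (q, j) := by
    ext p q
    simp [contract, Matrix.kronecker]
  rw [e]
  exact h2

theorem contract_mono [Fintype b] [Fintype α] [Fintype β] {W W' : Matrix (a × b) (a × b) ℂ}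
    {ρ ρ' : Matrix ((α × a) × β) ((α × a) × β) ℂ} (hW : 0 ≤ W) (hWW' : W ≤ W') (hρ' : 0 ≤ ρ')
    (h : ρ ≤ ρ') : contract W ρ ≤ contract W' ρ' := by
  calc contract W ρ ≤ contract W ρ' := by
        rw [← sub_nonneg, ← contract_sub_right]
        exact contract_nonneg hW (sub_nonneg.2 h)
    _ ≤ contract W' ρ' := by
        rw [← sub_nonneg, ← contract_sub_left]
        exact contract_nonneg (sub_nonneg.2 hWW') hρ'

/-- The partial trace over the second factor. -/
def partialTrace [Fintype b] (W : Matrix (a × b) (a × b) ℂ) : Matrix a a ℂ :=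
  Matrix.of fun i j => ∑ z, W (i, z) (j, z)

theorem trace_contract_le [Fintype b] [Fintype α] [Fintype β] [DecidableEq a]
    {W : Matrix (a × b) (a × b) ℂ} {r : ℝ}
    (hW : partialTrace W ≤ r • (1 : Matrix a a ℂ))
    {ρ : Matrix ((α × a) × β) ((α × a) × β) ℂ} (hρ : 0 ≤ ρ) :
    (contract W ρ).trace.re ≤ r * ρ.trace.re := by
  -- The positive operator `r • 1 - Tr_b W` is contracted with `ρ`, its output system being trivial;
  -- the trace of the result is the gap in the claim.
  have h := contract_nonneg (b := Unit)
    (nonneg_submatrix (sub_nonneg.2 hW) (Prod.fst : a × Unit → a)) hρ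
  have h2 := re_trace_nonneg h
  have e : (contract (((r • (1 : Matrix a a ℂ)) - partialTrace W).submatrix
      (Prod.fst : a × Unit → a) Prod.fst) ρ).trace = r * ρ.trace - (contract W ρ).trace := by
    simp only [Matrix.trace, Matrix.diag_apply, contract, Matrix.of_apply, Matrix.submatrix_apply,
      Matrix.sub_apply, Matrix.smul_apply, partialTrace, mul_sub, Finset.sum_sub_distrib,
      Fintype.sum_prod_type, Finset.univ_unique, Finset.sum_singleton, Matrix.one_apply,
      Finset.mul_sum]
    congr 1
    · refine Finset.sum_congr rfl fun x _ => ?_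
      rw [Finset.sum_comm]
      refine Finset.sum_congr rfl fun i _ => Finset.sum_congr rfl fun y _ => ?_
      simp [mul_comm]
    · refine Finset.sum_congr rfl fun x _ => ?_
      rw [Finset.sum_comm]
      rw [Finset.sum_comm]
      conv_rhs => rw [Finset.sum_comm]
      refine Finset.sum_congr rfl fun y _ => ?_
      conv_rhs => rw [Finset.sum_comm]
      refine Finset.sum_congr rfl fun i _ => ?_
      rw [Finset.sum_comm]
  rw [e, Complex.sub_re, Complex.re_ofReal_mul] at h2
  linarith

end

/-! ### Minimax -/

/-- A minimax theorem for a real bilinear form, one of whose variables ranges over a compact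
convex set. -/
theorem exists_forall_le_of_forall_exists_le {E F : Type*}
    [TopologicalSpace E] [AddCommGroup E] [Module ℝ E] [IsTopologicalAddGroup E]
    [ContinuousSMul ℝ E] [TopologicalSpace F] [AddCommGroup F] [Module ℝ F]
    [IsTopologicalAddGroup F] [ContinuousSMul ℝ F]
    {X : Set E} {Y : Set F} (hX : X.Nonempty) (cX : Convex ℝ X) (kX : IsCompact X)
    (cY : Convex ℝ Y) (f : E →ₗ[ℝ] F →ₗ[ℝ] ℝ)
    (hf₁ : ∀ y, Continuous fun x => f x y) (hf₂ : ∀ x, Continuous (f x))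
    {r r' : ℝ} (hr : r < r') (h : ∀ x ∈ X, ∃ y ∈ Y, f x y ≤ r) :
    ∃ y ∈ Y, ∀ x ∈ X, f x y ≤ r' := by
  have mono : Monotone (fun t : ℝ => (t : EReal)) := EReal.coe_strictMono.monotone
  have hvex (y : F) : QuasiconvexOn ℝ X ((fun t : ℝ => (t : EReal)) ∘ fun x => -(f x y)) :=
    QuasiconvexOn.monotone_comp mono ((-(f.flip y)).convexOn cX).quasiconvexOn
  have hcave (x : E) : QuasiconcaveOn ℝ Y ((fun t : ℝ => (t : EReal)) ∘ fun y => -(f x y)) :=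
    QuasiconcaveOn.monotone_comp mono ((-(f x)).concaveOn cY).quasiconcaveOn
  have key := Sion.minimax' (f := fun x y => ((-(f x y) : ℝ) : EReal)) hX cX kX
    (fun y _ =>
      (continuous_coe_real_ereal.comp (hf₁ y).neg).lowerSemicontinuous.lowerSemicontinuousOn _)
    (fun y _ => hvex y)
    cY
    (fun x _ =>
      (continuous_coe_real_ereal.comp (hf₂ x).neg).upperSemicontinuous.upperSemicontinuousOn _)
    (fun x _ => hcave x)
  -- The supremum over the possibly noncompact `Y` need not be attained; the strict inequality `r <
  -- r'` still yields an actual `y`.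
  have h1 : ((-r' : ℝ) : EReal) < ⨅ x ∈ X, ⨆ y ∈ Y, ((-(f x y) : ℝ) : EReal) := by
    refine lt_of_lt_of_le (EReal.coe_lt_coe_iff.2 (neg_lt_neg hr)) ?_
    refine le_iInf₂ fun x hx => ?_
    obtain ⟨y, hy, hxy⟩ := h x hx
    exact (EReal.coe_le_coe_iff.2 (neg_le_neg hxy)).trans
      (le_iSup₂ (f := fun y (_ : y ∈ Y) => ((-(f x y) : ℝ) : EReal)) y hy)
  rw [key, lt_iSup_iff] at h1
  obtain ⟨y, h1⟩ := h1
  rw [lt_iSup_iff] at h1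
  obtain ⟨hy, h1⟩ := h1
  refine ⟨y, hy, fun x hx => ?_⟩
  have h2 := h1.le.trans (iInf₂_le x hx)
  rw [EReal.coe_le_coe_iff] at h2
  linarith

/-! ### Fidelity with a pure state -/

theorem ketBra_mul_mul_ketBra {ι : Type*} [Fintype ι] (φ : ι → ℂ) (X : Matrix ι ι ℂ) :
    ketBra φ * X * ketBra φ = (star φ ⬝ᵥ X *ᵥ φ) • ketBra φ := by
  rw [ketBra, Matrix.mul_assoc, Matrix.mul_vecMulVec, Matrix.vecMulVec_mul_vecMulVec]
  simp

/-- With `c = ⟨φ, τ φ⟩`, the square of `|√τ |φ⟩⟨φ||` is `|φ⟩⟨φ| τ |φ⟩⟨φ| = c |φ⟩⟨φ|`, so this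
absolute value is `√c |φ⟩⟨φ|`. -/
theorem fidelity_ketBra {ι : Type*} [Fintype ι] [DecidableEq ι] {τ : Matrix ι ι ℂ} (hτ : 0 ≤ τ)
    {φ : ι → ℂ} (hφ : star φ ⬝ᵥ φ = 1) :
    fidelity τ (ketBra φ) = (star φ ⬝ᵥ τ *ᵥ φ).re := by
  have h0 : 0 ≤ ketBra φ := ketBra_nonneg φ
  have hsq : ketBra φ * ketBra φ = ketBra φ := by
    have := ketBra_mul_mul_ketBra φ 1
    simpa [hφ] using this
  have hs : CFC.sqrt (ketBra φ) = ketBra φ := CFC.sqrt_unique hsq h0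
  have hc : 0 ≤ star φ ⬝ᵥ τ *ᵥ φ :=
    (Matrix.nonneg_iff_posSemidef.1 hτ).dotProduct_mulVec_nonneg φ
  obtain ⟨c, hc0, hc⟩ : ∃ c : ℝ, 0 ≤ c ∧ star φ ⬝ᵥ τ *ᵥ φ = c :=
    ⟨_, (Complex.nonneg_iff.1 hc).1, Complex.ext rfl (Complex.nonneg_iff.1 hc).2.symm⟩
  have hst : star (CFC.sqrt τ) = CFC.sqrt τ :=
    (IsSelfAdjoint.of_nonneg (CFC.sqrt_nonneg τ)).star_eq
  have hsk : star (ketBra φ) = ketBra φ := (IsSelfAdjoint.of_nonneg h0).star_eq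
  have habs : CFC.abs (CFC.sqrt τ * CFC.sqrt (ketBra φ)) = (Real.sqrt c) • ketBra φ := by
    rw [hs]
    refine CFC.sqrt_unique ?_ (smul_nonneg_of_nonneg h0 (Real.sqrt_nonneg c))
    rw [star_mul, hst, hsk, smul_mul_smul_comm, hsq, Real.mul_self_sqrt hc0]
    calc (c : ℝ) • ketBra φ = ketBra φ * τ * ketBra φ := by
          rw [ketBra_mul_mul_ketBra, hc]; ext i j; simp
      _ = ketBra φ * (CFC.sqrt τ * CFC.sqrt τ) * ketBra φ := by
          rw [CFC.sqrt_mul_sqrt_self τ hτ]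
      _ = _ := by simp only [Matrix.mul_assoc]
  have htr : (ketBra φ).trace = 1 := by
    rw [ketBra, Matrix.trace_vecMulVec, dotProduct_comm, hφ]
  rw [fidelity, traceNorm, habs, Matrix.trace_smul, htr, hc]
  simp [Real.sq_sqrt hc0]

theorem fidelity_maxEntangledState {M : ℕ} (hM : 1 ≤ M)
    {τ : Matrix (Fin M × Fin M) (Fin M × Fin M) ℂ} (hτ : 0 ≤ τ) :
    fidelity τ (maxEntangledState M) = (1 / M : ℝ) * ∑ i, ∑ j, (τ (i, i) (j, j)).re := by
  have hM' : (M : ℝ) ≠ 0 := by positivity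
  have hr : (Real.sqrt M)⁻¹ * (Real.sqrt M)⁻¹ = (M : ℝ)⁻¹ := by
    rw [← mul_inv, Real.mul_self_sqrt (Nat.cast_nonneg M)]
  have hc : ((Real.sqrt M : ℝ) : ℂ)⁻¹ * ((Real.sqrt M : ℝ) : ℂ)⁻¹ = (M : ℂ)⁻¹ := by
    rw [← Complex.ofReal_inv, ← Complex.ofReal_mul, hr, Complex.ofReal_inv, Complex.ofReal_natCast]
  rw [maxEntangledState, fidelity_ketBra hτ]
  · have : (star (fun p : Fin M × Fin M => if p.1 = p.2 then ((1 / Real.sqrt M : ℝ) : ℂ) else 0) ⬝ᵥ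
        τ *ᵥ fun p : Fin M × Fin M => if p.1 = p.2 then ((1 / Real.sqrt M : ℝ) : ℂ) else 0) =
        ((1 / M : ℝ) : ℂ) * ∑ i, ∑ j, τ (i, i) (j, j) := by
      simp only [dotProduct, Matrix.mulVec, Fintype.sum_prod_type, Pi.star_apply]
      simp only [apply_ite star, star_zero, ite_mul, zero_mul, mul_ite, mul_zero,
        Finset.sum_ite_eq, Finset.mem_univ, if_true]
      simp only [Finset.mul_sum]
      refine Finset.sum_congr rfl fun i _ => Finset.sum_congr rfl fun j _ => ?_
      simp only [one_div, Complex.ofReal_inv, Complex.star_def, map_inv₀, Complex.conj_ofReal,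
        Complex.ofReal_natCast]
      rw [← hc]; ring
    rw [this, Complex.re_ofReal_mul]
    simp
  · simp only [dotProduct, Fintype.sum_prod_type, Pi.star_apply]
    simp only [apply_ite star, star_zero, ite_mul, zero_mul, mul_ite, mul_zero,
        Finset.sum_ite_eq, Finset.mem_univ, if_true]
    simp [hc]
    field_simp

/-! ### The max-Rains bound along a protocol -/

section

variable {a b α β α' β' : Type*} [Fintype a] [Fintype b] [Fintype α] [Fintype β] [Fintype α']
  [Fintype β']

/-- A certificate that `2 ^ R_max(A;B)_ρ ≤ s`: the operator `ρ ≥ 0` is dominated by the partial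
transpose of `P - Q`, where `P, Q ≥ 0` and `Tr (P + Q) ≤ s`. -/
def HasRainsBound (ρ : Matrix (α × β) (α × β) ℂ) (s : ℝ) : Prop :=
  0 ≤ ρ ∧ ∃ P Q : Matrix (α × β) (α × β) ℂ, 0 ≤ P ∧ 0 ≤ Q ∧
    ρ ≤ partialTranspose (P - Q) ∧ (P + Q).trace.re ≤ s

/-- A certificate that the channel with Choi matrix `J` has max-Rains information at most
`log r`. -/
def HasChannelRainsBound [DecidableEq a] (J : Matrix (a × b) (a × b) ℂ) (r : ℝ) : Prop :=
  ∃ V Y : Matrix (a × b) (a × b) ℂ, 0 ≤ V ∧ 0 ≤ Y ∧ J ≤ partialTranspose (V - Y) ∧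
    partialTrace (V + Y) ≤ r • (1 : Matrix a a ℂ)

/-- On a trivial system `T_B` fixes `1`, so PPT preservation makes `T_B (L 1)` positive; it serves
as `P`, with `Q = 0`. -/
theorem HasRainsBound.prepare
    {L : Matrix (Unit × Unit) (Unit × Unit) ℂ →ₗ[ℂ] Matrix (α × β) (α × β) ℂ}
    (hL : IsPPTPreserving L) : HasRainsBound (L 1) 1 := by
  have h1 : (0 : Matrix (Unit × Unit) (Unit × Unit) ℂ) ≤ 1 :=
    Matrix.nonneg_iff_posSemidef.2 Matrix.PosSemidef.one
  have hT : partialTranspose (1 : Matrix (Unit × Unit) (Unit × Unit) ℂ) = 1 := by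
    ext p q; rfl
  refine ⟨hL.1.1.map_nonneg h1, partialTranspose (L 1), 0, ?_, le_rfl, ?_, ?_⟩
  · have := hL.2.1.map_nonneg h1
    simpa [hT] using this
  · simp
  · rw [add_zero, trace_partialTranspose, hL.1.2]
    simp

/-- `L` preserves the operator inequality, while `T ∘ L ∘ T` acts on `P` and `Q`, keeping their
positivity and trace. -/
theorem HasRainsBound.map {ρ : Matrix (α × β) (α × β) ℂ} {s : ℝ} (h : HasRainsBound ρ s)
    {L : Matrix (α × β) (α × β) ℂ →ₗ[ℂ] Matrix (α' × β') (α' × β') ℂ}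
    (hL : IsPPTPreserving L) : HasRainsBound (L ρ) s := by
  obtain ⟨hρ, P, Q, hP, hQ, hle, hs⟩ := h
  refine ⟨hL.1.1.map_nonneg hρ, _, _, hL.2.1.map_nonneg hP, hL.2.1.map_nonneg hQ, ?_, ?_⟩
  · rw [← map_sub]
    exact hL.1.1.map_mono hle
  · rwa [← map_add, hL.2.2]

theorem HasRainsBound.useChannel [DecidableEq a] {N : Matrix a a ℂ →ₗ[ℂ] Matrix b b ℂ}
    (hN : IsCompletelyPositive N) {r : ℝ} (hr : 0 ≤ r) (hNr : HasChannelRainsBound (choi N) r)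
    {ρ : Matrix ((α × a) × β) ((α × a) × β) ℂ} {s : ℝ} (h : HasRainsBound ρ s) :
    HasRainsBound (useChannel N ρ) (r * s) := by
  obtain ⟨hρ, P, Q, hP, hQ, hle, hs⟩ := h
  obtain ⟨V, Y, hV, hY, hJ, htr⟩ := hNr
  rw [useChannel_eq_contract]
  -- The new pair consists of the terms with sign plus and minus in `(V - Y)(P - Q)`; its sum is `(V
  -- + Y)(P + Q)`, whose trace is at most `r * s`.
  refine ⟨contract_nonneg (choi_nonneg hN) hρ, contract V P + contract Y Q,
    contract V Q + contract Y P, add_nonneg (contract_nonneg hV hP) (contract_nonneg hY hQ),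
    add_nonneg (contract_nonneg hV hQ) (contract_nonneg hY hP), ?_, ?_⟩
  · have e : contract V P + contract Y Q - (contract V Q + contract Y P) =
        contract (V - Y) (P - Q) := by
      rw [contract_sub_left, contract_sub_right, contract_sub_right]
      abel
    rw [e, partialTranspose_contract]
    exact contract_mono (choi_nonneg hN) hJ (hρ.trans hle) hle
  · have e : contract V P + contract Y Q + (contract V Q + contract Y P) =
        contract (V + Y) (P + Q) := by
      rw [contract_add_left, contract_add_right, contract_add_right]
      abel
    rw [e]
    exact (trace_contract_le htr (add_nonneg hP hQ)).trans (mul_le_mul_of_nonneg_left hs hr)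

/-- The sum is the real part of the trace of `P` times the swap operator, whose eigenvalues are
`±1`. -/
theorem abs_sum_swap_le {M : ℕ} {P : Matrix (Fin M × Fin M) (Fin M × Fin M) ℂ} (hP : 0 ≤ P) :
    |∑ i, ∑ j, (P (i, j) (j, i)).re| ≤ P.trace.re := by
  have h : ∑ i, ∑ j, |(P (i, j) (j, i)).re| ≤
      ∑ i, ∑ j, ((P (i, j) (i, j)).re + (P (j, i) (j, i)).re) / 2 := by
    refine Finset.sum_le_sum fun i _ => Finset.sum_le_sum fun j _ => ?_
    have := two_mul_re_le_of_nonneg hP (i, j) (j, i)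
    rw [abs_mul, abs_two] at this
    linarith
  have e : ∑ i, ∑ j, ((P (i, j) (i, j)).re + (P (j, i) (j, i)).re) / 2 = P.trace.re := by
    simp only [add_div, Finset.sum_add_distrib]
    rw [Finset.sum_comm (f := fun i j => (P (j, i) (j, i)).re / 2), ← Finset.sum_add_distrib]
    simp only [← Finset.sum_add_distrib, add_halves, Matrix.trace, Matrix.diag_apply,
      Fintype.sum_prod_type, Complex.re_sum]
  rw [← e]
  refine le_trans ?_ h
  exact (Finset.abs_sum_le_sum_abs _ _).trans
    (Finset.sum_le_sum fun i _ => Finset.abs_sum_le_sum_abs _ _)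

theorem HasRainsBound.fidelity_le {M : ℕ} (hM : 1 ≤ M)
    {ω : Matrix (Fin M × Fin M) (Fin M × Fin M) ℂ} {s : ℝ} (h : HasRainsBound ω s) :
    fidelity ω (maxEntangledState M) ≤ s / M := by
  obtain ⟨hω, P, Q, hP, hQ, hle, hs⟩ := h
  have hM' : (0 : ℝ) < M := by positivity
  -- The overlap with `Φ` is linear, so its nonnegativity on this difference compares `ω` with `T_B
  -- (P - Q)`.
  have hd : 0 ≤ fidelity (partialTranspose (P - Q) - ω) (maxEntangledState M) := sq_nonneg _
  rw [fidelity_maxEntangledState hM (sub_nonneg.2 hle)] at hd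
  rw [fidelity_maxEntangledState hM hω, one_div_mul_eq_div]
  rw [one_div_mul_eq_div, le_div_iff₀ hM', zero_mul] at hd
  refine div_le_div_of_nonneg_right ?_ hM'.le
  simp only [Matrix.sub_apply, partialTranspose_apply, Complex.sub_re,
    Finset.sum_sub_distrib] at hd
  have h1 := (abs_le.1 (abs_sum_swap_le hP)).2
  have h2 := (abs_le.1 (abs_sum_swap_le hQ)).1
  rw [Matrix.trace_add, Complex.add_re] at hs
  linarith

theorem PPTPProtocol.hasRainsBound_stateBefore [DecidableEq a]
    {N : Matrix a a ℂ →ₗ[ℂ] Matrix b b ℂ} (hN : IsCompletelyPositive N) {r : ℝ} (hr : 0 ≤ r)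
    (hNr : HasChannelRainsBound (choi N) r) {n M : ℕ} (P : PPTPProtocol a b n M) (i : ℕ)
    (hi : i < n) : HasRainsBound (P.stateBefore N i) (r ^ i) := by
  induction i with
  | zero =>
    rw [pow_zero]
    exact HasRainsBound.prepare P.first_ppt
  | succ i ih =>
    rw [pow_succ']
    exact (HasRainsBound.useChannel hN hr hNr (ih (by omega))).map (P.next_ppt i hi)

theorem PPTPProtocol.hasRainsBound_finalState [DecidableEq a]
    {N : Matrix a a ℂ →ₗ[ℂ] Matrix b b ℂ} (hN : IsCompletelyPositive N) {r : ℝ} (hr : 0 ≤ r)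
    (hNr : HasChannelRainsBound (choi N) r) {n M : ℕ} (hn : 1 ≤ n) (P : PPTPProtocol a b n M) :
    HasRainsBound (P.finalState N) (r ^ n) := by
  -- The state before use `n - 1` has undergone `n - 1` uses; this last one raises the exponent to
  -- `n`.
  have h := HasRainsBound.useChannel hN hr hNr
    (P.hasRainsBound_stateBefore hN hr hNr (n - 1) (by omega))
  rw [← pow_succ', Nat.sub_add_cancel hn] at h
  exact h.map P.last_ppt

end

/-! ### Optimization over input states -/

section

variable {a b : Type*} [Fintype a] [Fintype b]

theorem exists_decomposition_of_maxRainsEntropy_lt [DecidableEq a] [DecidableEq b]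
    {ω : Matrix (a × b) (a × b) ℂ} {R : ℝ}
    (h : maxRainsEntropy ω < (R : EReal)) :
    ∃ P Q : Matrix (a × b) (a × b) ℂ, 0 ≤ P ∧ 0 ≤ Q ∧
      ω ≤ ((2 : ℝ) ^ R) • partialTranspose (P - Q) ∧ (P + Q).trace.re ≤ 1 := by
  simp only [maxRainsEntropy, iInf_lt_iff] at h
  obtain ⟨σ, ⟨hσ, htr⟩, h⟩ := h
  simp only [Dmax, iInf_lt_iff] at h
  obtain ⟨r, hr, hrR⟩ := h
  have hrR' : r ≤ R := (EReal.coe_lt_coe_iff.1 hrR).le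
  have hsa : IsSelfAdjoint (partialTranspose σ) := by
    have h1 : IsSelfAdjoint σ := IsSelfAdjoint.of_nonneg hσ
    refine Matrix.ext fun p q => ?_
    exact congrFun (congrFun h1.star_eq (p.1, q.2)) (q.1, p.2)
  -- For the Jordan decomposition of the Hermitian `T_B(σ)`, the trace of the sum of the two parts
  -- is the trace norm.
  refine ⟨(partialTranspose σ)⁺, (partialTranspose σ)⁻, CFC.posPart_nonneg _,
    CFC.negPart_nonneg _, ?_, ?_⟩
  · rw [CFC.posPart_sub_negPart _ hsa, partialTranspose_partialTranspose]
    refine hr.trans ?_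
    rw [← sub_nonneg, ← sub_smul]
    exact smul_nonneg_of_nonneg hσ
      (sub_nonneg.2 (Real.rpow_le_rpow_of_exponent_le one_le_two hrR'))
  · rw [CFC.posPart_add_negPart _ hsa]
    exact htr

/-- Conjugation by `B` on the first tensor factor. -/
def localConj [DecidableEq b]
    (B : Matrix a a ℂ) (X : Matrix (a × b) (a × b) ℂ) : Matrix (a × b) (a × b) ℂ :=
  Matrix.kronecker B (1 : Matrix b b ℂ) * X * (Matrix.kronecker B (1 : Matrix b b ℂ))ᴴ

theorem localConj_apply [DecidableEq b]
    (B : Matrix a a ℂ) (X : Matrix (a × b) (a × b) ℂ) (p q : a × b) :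
    localConj B X p q = ∑ i, ∑ j, B p.1 i * star (B q.1 j) * X (i, p.2) (j, q.2) := by
  simp only [localConj, Matrix.mul_apply, Matrix.conjTranspose_apply, Matrix.kronecker,
    Matrix.kroneckerMap_apply, Fintype.sum_prod_type, Matrix.one_apply, mul_ite, mul_one, mul_zero,
    ite_mul, zero_mul, Finset.sum_ite_eq, Finset.mem_univ, if_true, apply_ite star, star_zero]
  simp only [Finset.sum_mul]
  rw [Finset.sum_comm]
  refine Finset.sum_congr rfl fun i _ => Finset.sum_congr rfl fun j _ => ?_
  ring

theorem localConj_nonneg [DecidableEq b]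
    (B : Matrix a a ℂ) {X : Matrix (a × b) (a × b) ℂ} (hX : 0 ≤ X) :
    0 ≤ localConj B X :=
  nonneg_conj hX _

theorem localConj_sub [DecidableEq b] (B : Matrix a a ℂ) (X Y : Matrix (a × b) (a × b) ℂ) :
    localConj B (X - Y) = localConj B X - localConj B Y := by
  simp [localConj, mul_sub, sub_mul]

theorem localConj_add [DecidableEq b] (B : Matrix a a ℂ) (X Y : Matrix (a × b) (a × b) ℂ) :
    localConj B (X + Y) = localConj B X + localConj B Y := by
  simp [localConj, mul_add, add_mul]

theorem localConj_smul [DecidableEq b] (B : Matrix a a ℂ) (t : ℝ) (X : Matrix (a × b) (a × b) ℂ) :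
    localConj B (t • X) = t • localConj B X := by
  simp [localConj]

theorem localConj_localConj [DecidableEq a] [DecidableEq b]
    (B C : Matrix a a ℂ) (X : Matrix (a × b) (a × b) ℂ) :
    localConj B (localConj C X) = localConj (B * C) X := by
  have : Matrix.kronecker (B * C) (1 : Matrix b b ℂ) =
      Matrix.kronecker B (1 : Matrix b b ℂ) * Matrix.kronecker C (1 : Matrix b b ℂ) := by
    have := Matrix.mul_kronecker_mul B C (1 : Matrix b b ℂ) (1 : Matrix b b ℂ)
    rwa [mul_one] at this
  simp only [localConj, this, Matrix.conjTranspose_mul, Matrix.mul_assoc]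

theorem localConj_one [DecidableEq a] [DecidableEq b]
    (X : Matrix (a × b) (a × b) ℂ) : localConj 1 X = X := by
  simp [localConj]

theorem partialTranspose_localConj [DecidableEq b]
    (B : Matrix a a ℂ) (X : Matrix (a × b) (a × b) ℂ) :
    partialTranspose (localConj B X) = localConj B (partialTranspose X) := by
  ext p q
  simp [partialTranspose_apply, localConj_apply]

theorem trace_localConj [DecidableEq b] (B : Matrix a a ℂ) (X : Matrix (a × b) (a × b) ℂ) :
    (localConj B X).trace = (Bᴴ * B * partialTrace X).trace := by
  simp only [Matrix.trace, Matrix.diag_apply, localConj_apply, Matrix.mul_apply, partialTrace,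
    Matrix.of_apply, Fintype.sum_prod_type, Matrix.conjTranspose_apply, Finset.sum_mul,
    Finset.mul_sum]
  have e1 : ∀ x : a, ∑ z : b, ∑ i, ∑ j, B x i * star (B x j) * X (i, z) (j, z) =
      ∑ j, ∑ i, ∑ z : b, star (B x j) * B x i * X (i, z) (j, z) := by
    intro x
    rw [Finset.sum_comm]
    conv_rhs => rw [Finset.sum_comm]
    refine Finset.sum_congr rfl fun i _ => ?_
    rw [Finset.sum_comm]
    exact Finset.sum_congr rfl fun j _ => Finset.sum_congr rfl fun z _ => by ring
  simp only [e1]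
  rw [Finset.sum_comm]
  refine Finset.sum_congr rfl fun j _ => ?_
  rw [Finset.sum_comm]
  refine Finset.sum_congr rfl fun i _ => ?_
  rw [Finset.sum_comm]

/-- A vector of `S ⊗ A` is a matrix of amplitudes `B`. By `trace_localConj`, only `Bᴴ * B` matters
for the traces, which reduces pure inputs to density matrices. -/
theorem idTensor_ketBra_eq_localConj [DecidableEq a] [DecidableEq b]
    (N : Matrix a a ℂ →ₗ[ℂ] Matrix b b ℂ) (B : Matrix a a ℂ) :
    idTensor a N (ketBra fun p => B p.1 p.2) = localConj B (choi N) := by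
  ext p q
  simp only [idTensor, Matrix.of_apply, map_apply_eq_choi, localConj_apply, ketBra,
    Matrix.vecMulVec, Pi.star_apply]

theorem trace_conjTranspose_mul_self_eq (B : Matrix a a ℂ) :
    (Bᴴ * B).trace = ((∑ p : a × a, ‖B p.1 p.2‖ ^ 2 : ℝ) : ℂ) := by
  simp only [Matrix.trace, Matrix.diag_apply, Matrix.mul_apply, Matrix.conjTranspose_apply,
    Fintype.sum_prod_type]
  rw [Finset.sum_comm]
  push_cast
  refine Finset.sum_congr rfl fun i _ => Finset.sum_congr rfl fun j _ => ?_
  rw [Complex.star_def, Complex.conj_mul']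

theorem partialTrace_nonneg {a b : Type*} [Fintype b] {X : Matrix (a × b) (a × b) ℂ} (hX : 0 ≤ X) :
    0 ≤ partialTrace X := by
  have : partialTrace X = ∑ z, X.submatrix (fun i => (i, z)) (fun i => (i, z)) := by
    ext i j
    simp [partialTrace, Matrix.sum_apply]
  rw [this]
  exact Finset.sum_nonneg fun z _ => nonneg_submatrix hX _

theorem exists_conjTranspose_mul_self [DecidableEq a]
    {ρ : Matrix a a ℂ} (hρ : 0 ≤ ρ) : ∃ B, Bᴴ * B = ρ :=
  ⟨CFC.sqrt ρ, by
    have : (CFC.sqrt ρ)ᴴ = CFC.sqrt ρ := (IsSelfAdjoint.of_nonneg (CFC.sqrt_nonneg ρ)).star_eq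
    rw [this, CFC.sqrt_mul_sqrt_self ρ hρ]⟩

theorem re_trace_mul_nonneg [DecidableEq a] {ρ X : Matrix a a ℂ} (hρ : 0 ≤ ρ) (hX : 0 ≤ X) :
    0 ≤ (ρ * X).trace.re := by
  obtain ⟨B, rfl⟩ := exists_conjTranspose_mul_self hρ
  rw [Matrix.mul_assoc, Matrix.trace_mul_comm]
  exact re_trace_nonneg (nonneg_conj hX B)

/-- The density matrices. -/
def densityMatrices (a : Type*) [Fintype a] : Set (Matrix a a ℂ) := {ρ | 0 ≤ ρ ∧ ρ.trace = 1}

theorem convex_densityMatrices : Convex ℝ (densityMatrices a) := by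
  rintro ρ ⟨hρ, hρ1⟩ ρ' ⟨hρ', hρ1'⟩ s t hs ht hst
  refine ⟨add_nonneg (smul_nonneg_of_nonneg hρ hs) (smul_nonneg_of_nonneg hρ' ht), ?_⟩
  rw [Matrix.trace_add, Matrix.trace_smul, Matrix.trace_smul, hρ1, hρ1', ← add_smul, hst, one_smul]

/-- The density matrices are the image of the Frobenius unit sphere under `B ↦ Bᴴ * B`. -/
theorem isCompact_densityMatrices [DecidableEq a] : IsCompact (densityMatrices a) := by
  have hS : IsCompact {B : a → a → ℂ | ∑ p : a × a, ‖B p.1 p.2‖ ^ 2 = 1} := by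
    refine Metric.isCompact_of_isClosed_isBounded ?_ ?_
    · exact isClosed_eq (by fun_prop) continuous_const
    · refine (Metric.isBounded_closedBall (x := (0 : a → a → ℂ)) (r := 1)).subset fun B hB => ?_
      rw [mem_closedBall_zero_iff, pi_norm_le_iff_of_nonneg zero_le_one]
      intro i
      rw [pi_norm_le_iff_of_nonneg zero_le_one]
      intro j
      have h := Finset.single_le_sum (f := fun p : a × a => ‖B p.1 p.2‖ ^ 2)
        (fun _ _ => sq_nonneg _) (Finset.mem_univ (i, j))
      have hB' : ∑ p : a × a, ‖B p.1 p.2‖ ^ 2 = 1 := hB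
      rw [hB'] at h
      exact (sq_le_one_iff₀ (norm_nonneg _)).1 h
  have hf : Continuous (fun B : a → a → ℂ => (Matrix.of B)ᴴ * Matrix.of B) := by
    have : Continuous (fun B : a → a → ℂ => (Matrix.of B : Matrix a a ℂ)) := continuous_id
    exact this.matrix_conjTranspose.matrix_mul this
  have := hS.image hf
  convert this using 1
  ext ρ
  constructor
  · rintro ⟨hρ, hρ1⟩
    obtain ⟨B, rfl⟩ := exists_conjTranspose_mul_self hρ
    rw [trace_conjTranspose_mul_self_eq] at hρ1
    exact ⟨B, by exact_mod_cast hρ1, rfl⟩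
  · rintro ⟨B, hB, rfl⟩
    refine ⟨Matrix.nonneg_iff_posSemidef.2 (Matrix.posSemidef_conjTranspose_mul_self _), ?_⟩
    rw [trace_conjTranspose_mul_self_eq]
    exact_mod_cast hB

/-- The pairs `(V, Y)` of positive semidefinite operators with `J ≤ T_B (V - Y)`. -/
def feasiblePairs (J : Matrix (a × b) (a × b) ℂ) :
    Set (Matrix (a × b) (a × b) ℂ × Matrix (a × b) (a × b) ℂ) :=
  {W | 0 ≤ W.1 ∧ 0 ≤ W.2 ∧ J ≤ partialTranspose (W.1 - W.2)}

theorem convex_feasiblePairs (J : Matrix (a × b) (a × b) ℂ) : Convex ℝ (feasiblePairs J) := by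
  rintro W ⟨h1, h2, h3⟩ W' ⟨h1', h2', h3'⟩ s t hs ht hst
  refine ⟨add_nonneg (smul_nonneg_of_nonneg h1 hs) (smul_nonneg_of_nonneg h1' ht),
    add_nonneg (smul_nonneg_of_nonneg h2 hs) (smul_nonneg_of_nonneg h2' ht), ?_⟩
  rw [← sub_nonneg] at h3 h3' ⊢
  have := add_nonneg (smul_nonneg_of_nonneg h3 hs) (smul_nonneg_of_nonneg h3' ht)
  convert this using 1
  have e : J = s • J + t • J := by rw [← add_smul, hst, one_smul]
  rw [smul_sub, smul_sub, ← partialTranspose_real_smul, ← partialTranspose_real_smul]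
  conv_lhs => rw [e]
  rw [Prod.fst_add, Prod.snd_add, Prod.smul_fst, Prod.smul_fst, Prod.smul_snd, Prod.smul_snd,
    add_sub_add_comm, ← smul_sub, ← smul_sub, map_add]
  abel

/-- The bilinear form `(ρ, (V, Y)) ↦ Tr (ρ Tr_B (V + Y))`. -/
def weight : Matrix a a ℂ →ₗ[ℝ]
    (Matrix (a × b) (a × b) ℂ × Matrix (a × b) (a × b) ℂ) →ₗ[ℝ] ℝ :=
  LinearMap.mk₂ ℝ (fun ρ W => (ρ * partialTrace (W.1 + W.2)).trace.re)
    (fun ρ ρ' W => by simp [add_mul])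
    (fun t ρ W => by simp)
    (fun ρ W W' => by
      rw [← Complex.add_re, ← Matrix.trace_add, ← Matrix.mul_add]
      congr 3
      ext i j
      simp only [partialTrace, Matrix.of_apply, Matrix.add_apply, Prod.fst_add, Prod.snd_add,
        Finset.sum_add_distrib]
      ring)
    (fun t ρ W => by
      rw [← Complex.smul_re, ← Matrix.trace_smul, ← Matrix.mul_smul]
      congr 3
      ext i j
      simp [partialTrace, Finset.mul_sum, Finset.sum_add_distrib])

theorem weight_apply (ρ : Matrix a a ℂ)
    (W : Matrix (a × b) (a × b) ℂ × Matrix (a × b) (a × b) ℂ) :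
    weight ρ W = (ρ * partialTrace (W.1 + W.2)).trace.re := rfl

/-- For `ρ = Bᴴ * B` with `B` invertible, the decomposition of the output state is pulled back by
`B⁻¹` to one of the Choi matrix; the weight at `ρ` undoes the pullback. -/
theorem exists_weight_le_of_posDef [DecidableEq a] [DecidableEq b]
    (N : Matrix a a ℂ →ₗ[ℂ] Matrix b b ℂ) {R : ℝ}
    (h : ∀ ψ : a × a → ℂ, ∑ x, ‖ψ x‖ ^ 2 = 1 →
      maxRainsEntropy (idTensor a N (ketBra ψ)) < (R : EReal))
    {ρ : Matrix a a ℂ} (hρ : ρ.PosDef) (hρ1 : ρ.trace = 1) :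
    ∃ W ∈ feasiblePairs (choi N), weight ρ W ≤ (2 : ℝ) ^ R := by
  obtain ⟨B, rfl⟩ := exists_conjTranspose_mul_self (Matrix.nonneg_iff_posSemidef.2 hρ.posSemidef)
  have hB : IsUnit B.det := by
    have := (Matrix.isUnit_iff_isUnit_det _).1 hρ.isUnit
    rw [Matrix.det_mul] at this
    exact isUnit_of_mul_isUnit_right this
  rw [trace_conjTranspose_mul_self_eq] at hρ1
  obtain ⟨P, Q, hP, hQ, hle, htr⟩ := exists_decomposition_of_maxRainsEntropy_lt
    (h (fun p => B p.1 p.2) (by exact_mod_cast hρ1))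
  rw [idTensor_ketBra_eq_localConj] at hle
  have hr : (0 : ℝ) ≤ 2 ^ R := by positivity
  have hinv (X : Matrix (a × b) (a × b) ℂ) : localConj B⁻¹ (localConj B X) = X := by
    rw [localConj_localConj, Matrix.nonsing_inv_mul B hB, localConj_one]
  have hinv' (X : Matrix (a × b) (a × b) ℂ) : localConj B (localConj B⁻¹ X) = X := by
    rw [localConj_localConj, Matrix.mul_nonsing_inv B hB, localConj_one]
  refine ⟨(((2 : ℝ) ^ R) • localConj B⁻¹ P, ((2 : ℝ) ^ R) • localConj B⁻¹ Q),
    ⟨smul_nonneg_of_nonneg (localConj_nonneg _ hP) hr,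
      smul_nonneg_of_nonneg (localConj_nonneg _ hQ) hr, ?_⟩, ?_⟩
  · rw [← smul_sub, ← localConj_sub, partialTranspose_real_smul, partialTranspose_localConj,
      ← localConj_smul, ← sub_nonneg, ← hinv (choi N), ← localConj_sub]
    exact localConj_nonneg _ (sub_nonneg.2 hle)
  · rw [weight_apply, ← trace_localConj, ← smul_add, ← localConj_add, localConj_smul, hinv',
      Matrix.trace_smul, Complex.smul_re, smul_eq_mul]
    exact mul_le_of_le_one_right hr htr

theorem exists_weight_le [DecidableEq a] [DecidableEq b]
    (N : Matrix a a ℂ →ₗ[ℂ] Matrix b b ℂ) {R : ℝ}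
    (h : ∀ ψ : a × a → ℂ, ∑ x, ‖ψ x‖ ^ 2 = 1 →
      maxRainsEntropy (idTensor a N (ketBra ψ)) < (R : EReal)) {r : ℝ} (hr : (2 : ℝ) ^ R < r)
    {ρ : Matrix a a ℂ} (hρ : ρ ∈ densityMatrices a) :
    ∃ W ∈ feasiblePairs (choi N), weight ρ W ≤ r := by
  have h2 : (0 : ℝ) < 2 ^ R := by positivity
  have hr0 : 0 < r := h2.trans hr
  have ha : Nonempty a := by
    by_contra ha
    rw [not_nonempty_iff] at ha
    simpa [Matrix.trace] using hρ.2
  have hd : (0 : ℝ) < Fintype.card a := by exact_mod_cast Fintype.card_pos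
  have ht0 : 0 < 2 ^ R / r := div_pos h2 hr0
  have ht1 : 2 ^ R / r < 1 := (div_lt_one hr0).2 hr
  -- Mixing `ρ` with a multiple of `1` makes it invertible; as the weight at `1` is nonnegative,
  -- this costs only the factor `1 / t`, and `2 ^ R / t = r`.
  set t : ℝ := 2 ^ R / r with ht
  set δ : ℝ := (1 - t) / Fintype.card a with hδ
  have hδ0 : 0 < δ := div_pos (sub_pos.2 ht1) hd
  have hone : (1 : Matrix a a ℂ).PosDef := Matrix.PosDef.one
  have hpos : (t • ρ + δ • (1 : Matrix a a ℂ)).PosDef :=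
    (hone.smul hδ0).posSemidef_add ((Matrix.nonneg_iff_posSemidef.1 hρ.1).smul ht0.le)
  have htr : (t • ρ + δ • (1 : Matrix a a ℂ)).trace = 1 := by
    rw [Matrix.trace_add, Matrix.trace_smul, Matrix.trace_smul, hρ.2, Matrix.trace_one,
      Complex.real_smul, Complex.real_smul, mul_one]
    have : t + δ * Fintype.card a = 1 := by rw [hδ]; field_simp; ring
    exact_mod_cast this
  obtain ⟨W, hW, hle⟩ := exists_weight_le_of_posDef N h hpos htr
  refine ⟨W, hW, ?_⟩
  have h1 : 0 ≤ weight (1 : Matrix a a ℂ) W :=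
    re_trace_mul_nonneg (Matrix.nonneg_iff_posSemidef.2 hone.posSemidef)
      (partialTrace_nonneg (add_nonneg hW.1 hW.2.1))
  rw [map_add, map_smul, map_smul, LinearMap.add_apply, LinearMap.smul_apply,
    LinearMap.smul_apply, smul_eq_mul, smul_eq_mul] at hle
  have h3 : t * weight ρ W ≤ 2 ^ R := by nlinarith [mul_nonneg hδ0.le h1]
  rwa [ht, div_mul_eq_mul_div, div_le_iff₀ hr0, mul_le_mul_iff_right₀ h2] at h3

theorem le_smul_one_of_forall_densityMatrices [DecidableEq a]
    {K : Matrix a a ℂ} (hK : 0 ≤ K) {r : ℝ}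
    (h : ∀ ρ ∈ densityMatrices a, (ρ * K).trace.re ≤ r) : K ≤ r • (1 : Matrix a a ℂ) := by
  have hK' := Matrix.nonneg_iff_posSemidef.1 hK
  refine Matrix.PosSemidef.of_dotProduct_mulVec_nonneg ?_ fun x => ?_
  · refine Matrix.IsHermitian.sub ?_ hK'.1
    ext i j
    simp [Matrix.one_apply, eq_comm, apply_ite (starRingEnd ℂ)]
  · have hc := hK'.dotProduct_mulVec_nonneg x
    have htr : (ketBra x * K).trace = star x ⬝ᵥ K *ᵥ x := by
      rw [Matrix.trace_mul_comm, ketBra, Matrix.mul_vecMulVec, Matrix.trace_vecMulVec,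
        dotProduct_comm]
    have hn : star x ⬝ᵥ x = ((∑ i, ‖x i‖ ^ 2 : ℝ) : ℂ) := by
      simp only [dotProduct, Pi.star_apply, Complex.star_def, Complex.conj_mul']
      push_cast
      rfl
    obtain ⟨t, ht, ht0⟩ : ∃ t : ℝ, ∑ i, ‖x i‖ ^ 2 = t ∧ 0 ≤ t :=
      ⟨_, rfl, Finset.sum_nonneg fun i _ => sq_nonneg ‖x i‖⟩
    rw [ht] at hn
    have hle : (star x ⬝ᵥ K *ᵥ x).re ≤ r * t := by
      rcases ht0.eq_or_lt with h0 | h0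
      · have hx : x = 0 := by
          rw [← h0] at hn
          exact dotProduct_star_self_eq_zero.1 (by rw [dotProduct_comm]; simpa using hn)
        simp [hx, ← h0]
      · have hρ : t⁻¹ • ketBra x ∈ densityMatrices a := by
          refine ⟨smul_nonneg_of_nonneg (ketBra_nonneg x) (inv_nonneg.2 h0.le), ?_⟩
          rw [Matrix.trace_smul, ketBra, Matrix.trace_vecMulVec, dotProduct_comm, hn,
            Complex.real_smul, ← Complex.ofReal_mul, inv_mul_cancel₀ h0.ne', Complex.ofReal_one]
        have := h _ hρ
        rw [Matrix.smul_mul, Matrix.trace_smul, htr, Complex.smul_re, smul_eq_mul,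
          inv_mul_le_iff₀ h0] at this
        linarith
    rw [Matrix.sub_mulVec, dotProduct_sub, Matrix.smul_mulVec, Matrix.one_mulVec,
      dotProduct_smul, hn, Complex.real_smul, ← Complex.ofReal_mul]
    rw [Complex.nonneg_iff] at hc ⊢
    rw [Complex.sub_re, Complex.sub_im, Complex.ofReal_re, Complex.ofReal_im, ← hc.2]
    exact ⟨sub_nonneg.2 hle, by simp⟩

/-- An upper bound on the max-Rains entropies of all outputs of the channel `N` yields a single
dual certificate for `N`. -/
theorem hasChannelRainsBound_of_forall_lt [DecidableEq a] [DecidableEq b]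
    {N : Matrix a a ℂ →ₗ[ℂ] Matrix b b ℂ} {R : ℝ}
    (h : ∀ ψ : a × a → ℂ, ∑ x, ‖ψ x‖ ^ 2 = 1 →
      maxRainsEntropy (idTensor a N (ketBra ψ)) < (R : EReal)) {r : ℝ} (hr : (2 : ℝ) ^ R < r) :
    HasChannelRainsBound (choi N) r := by
  rcases isEmpty_or_nonempty a with ha | ha
  · refine ⟨0, 0, le_rfl, le_rfl, (Subsingleton.elim _ _).le, (Subsingleton.elim _ _).le⟩
  -- The gap is spent twice: from `2 ^ R` to `r₁` on singular `ρ`, and from `r₁` to `r` on the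
  -- minimax theorem.
  obtain ⟨r₁, h1, h2⟩ := exists_between hr
  have hne : (densityMatrices a).Nonempty := by
    obtain ⟨i⟩ := ha
    refine ⟨ketBra (Pi.single i 1), ketBra_nonneg _, ?_⟩
    rw [ketBra, Matrix.trace_vecMulVec]
    simp
  obtain ⟨W, hW, hle⟩ := exists_forall_le_of_forall_exists_le hne convex_densityMatrices
    isCompact_densityMatrices (convex_feasiblePairs (choi N)) weight
    (fun W => LinearMap.continuous_of_finiteDimensional (weight.flip W))
    (fun ρ => LinearMap.continuous_of_finiteDimensional (weight ρ)) h2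
    (fun ρ hρ => exists_weight_le N h h1 hρ)
  exact ⟨W.1, W.2, hW.1, hW.2.1, hW.2.2,
    le_smul_one_of_forall_densityMatrices (partialTrace_nonneg (add_nonneg hW.1 hW.2.1)) hle⟩

end

/-! ### The converse bound -/

theorem PPTPProtocol.logb_le {a b : Type*} [Fintype a] [DecidableEq a] [Fintype b] [DecidableEq b]
    {N : Matrix a a ℂ →ₗ[ℂ] Matrix b b ℂ} (hN : IsCompletelyPositive N)
    {n M : ℕ} (hn : 1 ≤ n) (hM : 1 ≤ M) {ε : ℝ} (hε1 : ε < 1)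
    {P : PPTPProtocol a b n M} (hP : IsEpsProtocol N P ε) {R : ℝ}
    (hR : maxRainsInformation N < (R : EReal)) :
    Real.logb 2 M ≤ n * R + Real.logb 2 (1 / (1 - ε)) := by
  have h (ψ : a × a → ℂ) (hψ : ∑ x, ‖ψ x‖ ^ 2 = 1) :
      maxRainsEntropy (idTensor a N (ketBra ψ)) < (R : EReal) :=
    lt_of_le_of_lt (le_iSup₂ (f := fun (ψ : a × a → ℂ) (_ : ∑ x, ‖ψ x‖ ^ 2 = 1) =>
      maxRainsEntropy (idTensor a N (ketBra ψ))) ψ hψ) hR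
  have hM' : (0 : ℝ) < M := by positivity
  have hε : 0 < 1 - ε := sub_pos.2 hε1
  refine le_of_forall_pos_le_add fun η hη => ?_
  have hn' : (0 : ℝ) < n := by positivity
  -- The `n`-th power turns the slack `η / n` in the exponent into `η`.
  have hr : (2 : ℝ) ^ R < 2 ^ (R + η / n) :=
    Real.rpow_lt_rpow_of_exponent_lt one_lt_two (lt_add_of_pos_right R (div_pos hη hn'))
  have hF := ((P.hasRainsBound_finalState hN (by positivity)
    (hasChannelRainsBound_of_forall_lt h hr) hn).fidelity_le hM)
  have h1 : 1 - ε ≤ ((2 : ℝ) ^ (R + η / n)) ^ n / M := le_trans hP hF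
  rw [le_div_iff₀ hM', mul_comm, ← le_div_iff₀ hε] at h1
  have h2 := Real.logb_le_logb_of_le one_lt_two hM' h1
  have h3 : (0 : ℝ) < (2 : ℝ) ^ (R + η / n) := by positivity
  rw [div_eq_mul_one_div, Real.logb_mul (pow_pos h3 n).ne' (by positivity), Real.logb_pow,
    Real.logb_rpow two_pos (by norm_num), mul_add, mul_div_cancel₀ _ hn'.ne'] at h2
  linarith

end MaxRains

end

theorem mainTheorem3 {a b : Type*} [Fintype a] [DecidableEq a] [Fintype b] [DecidableEq b]
    (N : Matrix a a ℂ →ₗ[ℂ] Matrix b b ℂ) (hN : MaxRains.IsQuantumChannel N)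
    (n M : ℕ) (hn : 1 ≤ n) (hM : 1 ≤ M) (ε : ℝ) (hε0 : 0 < ε) (hε1 : ε < 1)
    (P : MaxRains.PPTPProtocol a b n M) (hP : MaxRains.IsEpsProtocol N P ε) :
    ((Real.logb 2 (M : ℝ) : ℝ) : EReal) ≤
      (n : EReal) * MaxRains.maxRainsInformation N
        + ((Real.logb 2 (1 / (1 - ε)) : ℝ) : EReal) := by
  have key (R : ℝ) (hR : MaxRains.maxRainsInformation N < (R : EReal)) :
      Real.logb 2 M ≤ n * R + Real.logb 2 (1 / (1 - ε)) :=
    MaxRains.PPTPProtocol.logb_le hN.1 hn hM hε1 hP hR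
  have hn' : (0 : ℝ) < n := by positivity
  induction h : MaxRains.maxRainsInformation N with
  -- Impossible: every real `R` would satisfy `key`, and this one makes its right side `logb 2 M -
  -- 1`.
  | bot =>
    exfalso
    have := key ((Real.logb 2 M - Real.logb 2 (1 / (1 - ε)) - 1) / n)
      (h ▸ EReal.bot_lt_coe _)
    rw [mul_div_cancel₀ _ hn'.ne'] at this
    linarith
  | top =>
    have : (n : EReal) * ⊤ = ⊤ := EReal.mul_top_of_pos (by exact_mod_cast hn)
    rw [this, EReal.top_add_coe]
    exact le_top
  | coe x =>
    have hx : Real.logb 2 M ≤ n * x + Real.logb 2 (1 / (1 - ε)) := by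
      refine le_of_forall_pos_le_add fun η hη => ?_
      have := key (x + η / n)
        (h ▸ EReal.coe_lt_coe_iff.2 (lt_add_of_pos_right x (div_pos hη hn')))
      rw [mul_add, mul_div_cancel₀ _ hn'.ne'] at this
      linarith
    exact_mod_cast hx
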